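/- A partition of length at most $n$ is written as a weakly decreasing tuple $\alpha=(\alpha_1\ge\dots\ge\alpha_n\ge 0)$ of integers (padded by zeros); its weight is $|\alpha|=\alpha_1+\dots+\alpha_n$. With $\delta_n=(n-1,\dots,1,0)$ and $a_e(x_1,\dots,x_n)=\det(x_i^{e_j})$, the Schur polynomial is $s_\alpha(x_1,\dots,x_n)=a_{\alpha+\delta_n}/a_{\delta_n}$. For $\lambda$ with $\ell(\lambda)\le 4$, put $X=(x_1,x_2)$, $Y=(y_1,y_2)$, $XY=(x_1y_1,x_1y_2,x_2y_1,x_2y_2)$. There is a unique finite expansion $$s_\lambda[XY]=\sum_{\mu,\nu} g_{\mu,\nu,\lambda}\,s_\mu[X]\,s_\nu[Y]\qquad(\ell(\mu),\ell(\nu)\le 2,\ g_{\mu,\nu,\lambda}\in\mathbb Z),$$ and the integers $g_{\mu,\nu,\lambda}$ are the Kronecker coefficients. Let $$\bar F_{2,2}(x,y)=\frac{1}{(1-y/x)(1-xy)(1-x)(1-y)},$$ expanded in the domain $0<|xy|<|y|<|x|<1$, that is, as an element of $\mathbb Q((x))((y))$. For $n,m\in\mathbb Z$ let $p_S(n,m)$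 be the number of $(v_1,v_2,v_3,v_4)\in\mathbb Z_{\ge 0}^4$ with $v_1+v_3+v_4=n$ and $v_2+v_3+2v_4=m$, the vector partition function of $S=\{(1,0),(0,1),(1,1),(1,2)\}$ (so $p_S(n,m)=0$ if $n<0$ or $m<0$). Let $P_\lambda(x,y)$ be the Laurent polynomial $$P_\lambda=y^{\lambda_3+\lambda_4}\bigl(x^{\lambda_2+\lambda_4}-x^{\lambda_2+\lambda_3+1}-x^{\lambda_1+\lambda_4+1}+x^{\lambda_1+\lambda_3+2}\bigr)+y^{\lambda_2+\lambda_4+1}\bigl(-x^{\lambda_3+\lambda_4-1}+x^{\lambda_2+\lambda_3+1}+x^{\lambda_1+\lambda_4+1}\bigr).$$ **Theorem.** Let $\lambda,\mu,\nu$ be partitions of the same weight with $\ell(\lambda)\le 4$, $\ell(\mu),\ell(\nu)\le 2$ and $\mu_2\ge\nu_2$. Then $g_{\mu,\nu,\lambda}$ is equal to each of the following: 1. the coefficient of $x^{\mu_2}y^{\nu_2}$ in $P_\lambda(x,y)\,\bar F_{2,2}(x,y)$. Moreover, a monomial $c\,y^bx^a$ ($c\ne 0$) occurring in $P_\lambda$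 makes a nonzero contribution to it (that is, the coefficient of $x^{\mu_2}y^{\nu_2}$ in $c\,y^bx^a\,\bar F_{2,2}$ is nonzero) if and only if $b\le\nu_2$ and $a+b\le\mu_2+\nu_2$; 2. the signed sum $$\begin{aligned}&q(\lambda_2+\lambda_4,\lambda_3+\lambda_4)-q(\lambda_2+\lambda_3+1,\lambda_3+\lambda_4)-q(\lambda_1+\lambda_4+1,\lambda_3+\lambda_4)+q(\lambda_1+\lambda_3+2,\lambda_3+\lambda_4)\\&-q(\lambda_3+\lambda_4-1,\lambda_2+\lambda_4+1)+q(\lambda_2+\lambda_3+1,\lambda_2+\lambda_4+1)+q(\lambda_1+\lambda_4+1,\lambda_2+\lambda_4+1),\end{aligned}$$ where $q(a,b)=p_S\bigl(\nu_2-b,\ (\nu_2-b)+(\mu_2-a)\bigr)$. -/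

import Mathlib

noncomputable section

namespace Kronecker

/-- Partitions of length at most `n`, written as weakly decreasing `n`-tuples (padded by zeros).
With indices starting at `0`, the part `α_{i+1}` is `α i`. -/
structure BoundedPartition (n : ℕ) where
  part : Fin n → ℕ
  antitone : Antitone part

instance (n : ℕ) : CoeFun (BoundedPartition n) (fun _ => Fin n → ℕ) :=
  ⟨BoundedPartition.part⟩

/-- The weight `|α|` of a partition. -/
def BoundedPartition.weight {n : ℕ} (α : BoundedPartition n) : ℕ := ∑ i, α i

/-- The staircase `δ_n = (n-1, n-2, …, 1, 0)`. -/
def staircase (n : ℕ) (j : Fin n) : ℕ := n - 1 - j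

/-- The alternant `a_e(x_1, …, x_n) = det (x_i ^ e_j)`. -/
def alternant {K : Type*} [CommRing K] {n : ℕ} (e : Fin n → ℕ) (x : Fin n → K) : K :=
  Matrix.det (Matrix.of fun i j => x i ^ e j)

/-- The Schur polynomial, as the quotient `a_{α+δ_n} / a_{δ_n}` of alternants, at a tuple `x`
of (pairwise distinct) elements of a field. -/
def schur {K : Type*} [Field K] {n : ℕ} (α : BoundedPartition n) (x : Fin n → K) : K :=
  alternant (fun j => α j + staircase n j) x / alternant (staircase n) x

/-- The field `ℚ(x_1, …, x_n, y_1, …, y_m)`. -/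
abbrev RatFunc2 (n m : ℕ) : Type := FractionRing (MvPolynomial (Fin n ⊕ Fin m) ℚ)

/-- The alphabet `X = (x_1, …, x_n)`. -/
def alphabetX (n m : ℕ) (i : Fin n) : RatFunc2 n m :=
  algebraMap (MvPolynomial (Fin n ⊕ Fin m) ℚ) (RatFunc2 n m) (MvPolynomial.X (Sum.inl i))

/-- The alphabet `Y = (y_1, …, y_m)`. -/
def alphabetY (n m : ℕ) (j : Fin m) : RatFunc2 n m :=
  algebraMap (MvPolynomial (Fin n ⊕ Fin m) ℚ) (RatFunc2 n m) (MvPolynomial.X (Sum.inr j))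

/-- The alphabet `XY = (x_1 y_1, x_1 y_2, …, x_n y_m)`. -/
def alphabetXY (n m : ℕ) (k : Fin (n * m)) : RatFunc2 n m :=
  alphabetX n m (finProdFinEquiv.symm k).1 * alphabetY n m (finProdFinEquiv.symm k).2

/-- `g` is the family of coefficients of an expansion
`s_λ[XY] = ∑_{μ,ν} g_{μ,ν} s_μ[X] s_ν[Y]`, a finite sum over partitions `μ`, `ν` with
`ℓ(μ) ≤ n` and `ℓ(ν) ≤ m`. -/
def IsKroneckerExpansion (n m : ℕ) (lam : BoundedPartition (n * m))
    (g : BoundedPartition n × BoundedPartition m →₀ ℤ) : Prop :=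
  schur lam (alphabetXY n m) =
    g.sum fun p c => (c : RatFunc2 n m) * schur p.1 (alphabetX n m) * schur p.2 (alphabetY n m)

open Classical in
/-- The Kronecker coefficient `g_{μ,ν,λ}`: the coefficient of `s_μ[X] s_ν[Y]` in the (unique)
expansion of `s_λ[XY]`. -/
def kroneckerCoeff {n m : ℕ} (mu : BoundedPartition n) (nu : BoundedPartition m)
    (lam : BoundedPartition (n * m)) : ℤ :=
  if h : ∃ g, IsKroneckerExpansion n m lam g then h.choose (mu, nu) else 0

/-- The field `ℚ((x))` of formal Laurent series in `x`. -/
def LaurentX : Type := LaurentSeries ℚ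

instance : Field LaurentX := inferInstanceAs (Field (LaurentSeries ℚ))

/-- The monomial `c * x ^ i` in `ℚ((x))`. -/
def LaurentX.monomial (i : ℤ) (c : ℚ) : LaurentX := (HahnSeries.single i c : LaurentSeries ℚ)

/-- The coefficient of `x ^ i` in an element of `ℚ((x))`. -/
def LaurentX.coeff (f : LaurentX) (i : ℤ) : ℚ := HahnSeries.coeff (f : LaurentSeries ℚ) i

/-- The field `ℚ((x))((y))` of iterated Laurent series: it carries the expansions of rational
functions in the domain `0 < |xy| < |y| < |x| < 1`. -/
abbrev IterLaurent : Type := LaurentSeries LaurentX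

/-- The constant `c` of `ℚ((x))((y))`. -/
def const (c : ℚ) : IterLaurent := HahnSeries.single (0 : ℤ) (LaurentX.monomial 0 c)

/-- The variable `x` of `ℚ((x))((y))`. -/
def varX : IterLaurent := HahnSeries.single (0 : ℤ) (LaurentX.monomial 1 1)

/-- The variable `y` of `ℚ((x))((y))`. -/
def varY : IterLaurent := HahnSeries.single (1 : ℤ) (1 : LaurentX)

/-- The coefficient of `x ^ i * y ^ j` in an element of `ℚ((x))((y))`. -/
def coeffXY (f : IterLaurent) (i j : ℤ) : ℚ := (HahnSeries.coeff f j).coeff i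

/-- The series `F̄_{2,2}(x,y) = 1 / ((1 - y/x)(1 - xy)(1 - x)(1 - y))`. -/
def Fbar22 : IterLaurent :=
  1 / ((1 - varY / varX) * (1 - varX * varY) * (1 - varX) * (1 - varY))

/-- The seven-term (Laurent) polynomial `P_λ(x,y)`; all exponents are integers. -/
def polyP (lam : BoundedPartition 4) : IterLaurent :=
  let l₁ : ℤ := lam 0
  let l₂ : ℤ := lam 1
  let l₃ : ℤ := lam 2
  let l₄ : ℤ := lam 3
  varY ^ (l₃ + l₄) *
      (varX ^ (l₂ + l₄) - varX ^ (l₂ + l₃ + 1) - varX ^ (l₁ + l₄ + 1) + varX ^ (l₁ + l₃ + 2)) +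
    varY ^ (l₂ + l₄ + 1) *
      (-varX ^ (l₃ + l₄ - 1) + varX ^ (l₂ + l₃ + 1) + varX ^ (l₁ + l₄ + 1))

/-- The vector partition function `p_S(n,m)` of `S = {(1,0), (0,1), (1,1), (1,2)}`: the number of
`v ∈ ℕ⁴` with `A v = (n,m)`, where the columns of `A` are the elements of `S`. -/
def pS (n m : ℤ) : ℕ :=
  Set.ncard {v : Fin 4 → ℕ |
    Matrix.mulVec !![1, 0, 1, 1; 0, 1, 1, 2] (fun i => (v i : ℤ)) = ![n, m]}

end Kronecker

end

/-! Multiply the expansion of `s_λ[XY]` by `a_δ(X) a_δ(Y)`. Both sides become polynomials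
antisymmetric in `X` and in `Y`. Such a polynomial is determined by its coefficients at strictly
dominant exponents, so `g_{μ,ν,λ}` is the coefficient at `(μ+δ, ν+δ)`
(`IsAntisymm.eq_sum_altProd_iff`, `isKroneckerExpansion_iff`).

By bihomogeneity nothing is lost on setting `x₁ = y₁ = 1`, `x₂ = x`, `y₂ = y`. The Vandermonde
product of `1, y, x, xy` is, up to `-x²y` and the factors `(1-x)(1-y)` that `a_δ(X) a_δ(Y)` cancels,
the denominator of `Fbar22`. Hence the polynomial specializes to `-x⁻²y⁻¹ a_{λ+δ}(1, y, x, xy)`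
times `Fbar22` (`specialize_antiSchurXY`).

The coefficients of `Fbar22` are values of `p_S` (`coeffXY_Fbar22`), so each of the 24 terms of the
determinant contributes one such value. For `ν₂ ≤ μ₂` and `2μ₂ ≤ |λ|`, thirteen of them lie outside
the cone where `p_S` is nonzero, and four cancel in pairs because `p_S(n, m)` does not depend on `m`
once `m ≥ 2n` (`rowTerm_sum_eq`, `pS_stable`). The seven others are the monomials of `P_λ`. The
contribution criterion says that `p_S` is nonzero exactly on the quadrant `n, m ≥ 0`. -/

noncomputable section

namespace Kronecker

/-! ### Coefficient extraction in the iterated Laurent series field. -/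

section LaurentCoefficients

theorem LaurentX.coeff_zero (i : ℤ) : LaurentX.coeff 0 i = 0 := rfl

theorem LaurentX.coeff_monomial_mul (a : ℤ) (c : ℚ) (f : LaurentX) (i : ℤ) :
    LaurentX.coeff (LaurentX.monomial a c * f) i = c * LaurentX.coeff f (i - a) :=
  HahnSeries.coeff_single_mul (Γ' := ℤ) (R := ℚ)

theorem LaurentX.coeff_one (i : ℤ) : LaurentX.coeff 1 i = if i = 0 then 1 else 0 := by
  convert HahnSeries.coeff_one (Γ := ℤ) (R := ℚ)
  rfl

theorem LaurentX.monomial_zpow (a : ℤ) :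
    LaurentX.monomial 1 1 ^ a = LaurentX.monomial a 1 :=
  (RatFunc.single_zpow (F := ℚ) a).symm

/-- Coefficient extraction in `ℚ((x))((y))` as an additive homomorphism. -/
def coeffXYHom (i j : ℤ) : IterLaurent →+ ℚ where
  toFun f := coeffXY f i j
  map_zero' := rfl
  map_add' _ _ := rfl

theorem coeffXYHom_apply (f : IterLaurent) (i j : ℤ) : coeffXYHom i j f = coeffXY f i j := rfl

theorem coeffXY_add (f g : IterLaurent) (i j : ℤ) :
    coeffXY (f + g) i j = coeffXY f i j + coeffXY g i j := rfl

theorem coeffXY_neg (f : IterLaurent) (i j : ℤ) :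
    coeffXY (-f) i j = -coeffXY f i j := map_neg (coeffXYHom i j) f

theorem coeffXY_sub (f g : IterLaurent) (i j : ℤ) :
    coeffXY (f - g) i j = coeffXY f i j - coeffXY g i j := map_sub (coeffXYHom i j) f g

theorem coeffXY_one (i j : ℤ) : coeffXY 1 i j = if i = 0 ∧ j = 0 then 1 else 0 := by
  unfold coeffXY
  rw [HahnSeries.coeff_one]
  by_cases hj : j = 0 <;> simp [hj, LaurentX.coeff_one, LaurentX.coeff_zero]

theorem IterLaurent.ext_coeffXY {f g : IterLaurent}
    (h : ∀ i j, coeffXY f i j = coeffXY g i j) : f = g := by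
  ext j
  exact HahnSeries.ext (funext fun i => h i j)

theorem varX_zpow (a : ℤ) :
    varX ^ a = HahnSeries.single (0 : ℤ) (LaurentX.monomial a 1) := by
  rw [← LaurentX.monomial_zpow]
  exact (map_zpow₀ (HahnSeries.C (Γ := ℤ) (R := LaurentX)) _ _).symm

theorem varY_zpow (b : ℤ) : varY ^ b = HahnSeries.single b (1 : LaurentX) :=
  (RatFunc.single_zpow (F := LaurentX) b).symm

theorem coeffXY_monomial_mul (a b : ℤ) (f : IterLaurent) (i j : ℤ) :
    coeffXY (varX ^ a * varY ^ b * f) i j = coeffXY f (i - a) (j - b) := by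
  rw [varX_zpow, varY_zpow, mul_assoc]
  unfold coeffXY
  rw [HahnSeries.coeff_single_mul, HahnSeries.coeff_single_mul, LaurentX.coeff_monomial_mul]
  simp

theorem coeffXY_const_mul (c : ℚ) (f : IterLaurent) (i j : ℤ) :
    coeffXY (const c * f) i j = c * coeffXY f i j := by
  unfold const coeffXY
  rw [HahnSeries.coeff_single_mul, LaurentX.coeff_monomial_mul]
  simp

theorem coeffXY_monomial (a b i j : ℤ) :
    coeffXY (varX ^ a * varY ^ b) i j = if i = a ∧ j = b then 1 else 0 := by
  rw [← mul_one (varX ^ a * varY ^ b), coeffXY_monomial_mul, coeffXY_one]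
  simp [sub_eq_zero]

theorem varX_ne_zero : varX ≠ 0 := by
  intro h
  simpa [h, coeffXY, LaurentX.coeff_zero] using coeffXY_monomial 1 0 1 0

theorem varY_ne_zero : varY ≠ 0 :=
  HahnSeries.single_ne_zero one_ne_zero

theorem coeffXY_one_sub_mul {v : IterLaurent} (a b : ℤ) (hv : v = varX ^ a * varY ^ b)
    (f : IterLaurent) (i j : ℤ) :
    coeffXY ((1 - v) * f) i j = coeffXY f i j - coeffXY f (i - a) (j - b) := by
  rw [sub_mul, one_mul, coeffXY_sub, hv, coeffXY_monomial_mul]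

/-- The element of `ℚ((x))((y))` with prescribed coefficients, supported in a cone. -/
def ofCoeff (c : ℤ → ℤ → ℚ) (h : ∀ i j, j < 0 ∨ i + j < 0 → c i j = 0) : IterLaurent :=
  HahnSeries.ofSuppBddBelow
    (fun j => (HahnSeries.ofSuppBddBelow (fun i => c i j) ⟨-j, fun i hi => by
      by_contra hlt
      exact hi (h i j (Or.inr (by omega)))⟩ : LaurentSeries ℚ))
    ⟨0, fun j hj => by
      by_contra hlt
      refine hj (HahnSeries.ext (funext fun i => h i j (Or.inl (by omega))))⟩

theorem coeffXY_ofCoeff (c : ℤ → ℤ → ℚ) (h : ∀ i j, j < 0 ∨ i + j < 0 → c i j = 0) (i j : ℤ) :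
    coeffXY (ofCoeff c h) i j = c i j := rfl

end LaurentCoefficients

/-! ### The vector partition function: support, recursion, stability. -/

section VectorPartitions

theorem pS_eq_ncard (n m : ℤ) : pS n m = Set.ncard {v : Fin 4 → ℕ |
    (v 0 : ℤ) + v 2 + v 3 = n ∧ (v 1 : ℤ) + v 2 + 2 * v 3 = m} := by
  unfold pS
  congr 1
  ext v
  simp only [Set.mem_ofPred_eq, funext_iff, Fin.forall_fin_two, Matrix.mulVec, dotProduct,
    Fin.sum_univ_four, Matrix.of_apply, Matrix.cons_val', Matrix.cons_val_zero,
    Matrix.cons_val_one, Matrix.cons_val]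
  constructor <;> rintro ⟨h1, h2⟩ <;> constructor <;> linarith

theorem pS_solutions_finite (n m : ℤ) : {v : Fin 4 → ℕ |
    (v 0 : ℤ) + v 2 + v 3 = n ∧ (v 1 : ℤ) + v 2 + 2 * v 3 = m}.Finite := by
  refine (Set.finite_Iic (fun _ : Fin 4 => n.toNat + m.toNat)).subset ?_
  rintro v ⟨h1, h2⟩
  refine Set.mem_Iic.2 fun i => ?_
  fin_cases i <;> simp <;> omega

theorem pS_eq_zero {n m : ℤ} (h : n < 0 ∨ m < 0) : pS n m = 0 := by
  rw [pS_eq_ncard, Set.ncard_eq_zero (pS_solutions_finite n m)]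
  ext v
  simp
  omega

theorem pS_pos {n m : ℤ} (hn : 0 ≤ n) (hm : 0 ≤ m) : pS n m ≠ 0 := by
  rw [pS_eq_ncard, ← Nat.pos_iff_ne_zero, Set.ncard_pos (pS_solutions_finite n m)]
  exact ⟨![n.toNat, m.toNat, 0, 0], by simp [hn], by simp [hm]⟩

/-- Without the vector `(1,2)`, a solution is determined by the multiplicity of `(1,1)`, which
ranges over `0, …, min n m`. The truncation `toNat` covers negative arguments. -/
theorem pS_slice (n m : ℤ) : Set.ncard {v : Fin 4 → ℕ |
    ((v 0 : ℤ) + v 2 + v 3 = n ∧ (v 1 : ℤ) + v 2 + 2 * v 3 = m) ∧ v 3 = 0} =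
      (min n m + 1).toNat := by
  have : {v : Fin 4 → ℕ |
      ((v 0 : ℤ) + v 2 + v 3 = n ∧ (v 1 : ℤ) + v 2 + 2 * v 3 = m) ∧ v 3 = 0} =
      (fun c : ℕ => ![n.toNat - c, m.toNat - c, c, 0]) ''
        (Finset.range (min n m + 1).toNat : Set ℕ) := by
    ext v
    simp only [Set.mem_ofPred_eq, Set.mem_image, Finset.coe_range, Set.mem_Iio]
    constructor
    · rintro ⟨⟨h1, h2⟩, h3⟩
      refine ⟨v 2, by omega, ?_⟩
      ext i
      fin_cases i <;> simp <;> omega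
    · rintro ⟨c, hc, rfl⟩
      simp
      omega
  rw [this, Set.ncard_image_of_injective, Set.ncard_coe_finset, Finset.card_range]
  intro c d h
  simpa using congrFun h 2

/-- Either `(1,2)` is unused, or one copy of it can be removed. -/
theorem pS_rec (n m : ℤ) : pS n m = (min n m + 1).toNat + pS (n - 1) (m - 2) := by
  have hinj : Function.Injective (fun v : Fin 4 → ℕ => ![v 0, v 1, v 2, v 3 + 1]) := by
    intro v w h
    ext i
    have := congrFun h i
    fin_cases i <;> simpa using this
  rw [← pS_slice, pS_eq_ncard, pS_eq_ncard (n - 1), 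
    ← Set.ncard_image_of_injective {v : Fin 4 → ℕ |
      (v 0 : ℤ) + v 2 + v 3 = n - 1 ∧ (v 1 : ℤ) + v 2 + 2 * v 3 = m - 2} hinj,
    ← Set.ncard_union_eq ?_ ((pS_solutions_finite n m).subset fun v h => h.1)
      ((pS_solutions_finite _ _).image _)]
  · congr 1
    ext v
    simp only [Set.mem_ofPred_eq, Set.mem_union, Set.mem_image]
    constructor
    · rintro ⟨h1, h2⟩
      by_cases h3 : v 3 = 0
      · exact Or.inl ⟨⟨h1, h2⟩, h3⟩
      · refine Or.inr ⟨![v 0, v 1, v 2, v 3 - 1], ?_, ?_⟩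
        · simp
          omega
        · ext i
          fin_cases i <;> simp
          omega
    · rintro (h | ⟨w, h, rfl⟩)
      · exact h.1
      · simp
        omega
  · rw [Set.disjoint_left]
    rintro v ⟨-, h⟩ ⟨w, -, rfl⟩
    simp at h

/-- Removing `(1,2)` preserves the region `m ≥ 2n`, and there the slice count is `n + 1` for `n ≥
0`, whatever `m` is. The bound `k` only serves to run the induction on an integer `n`. -/
theorem pS_stable (k : ℕ) : ∀ n m m' : ℤ, n < k → 2 * n ≤ m → 2 * n ≤ m' → pS n m = pS n m' := by
  induction k with
  | zero =>
    intro n m m' h _ _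
    have h : n < 0 := by simpa using h
    rw [pS_eq_zero (Or.inl h), pS_eq_zero (Or.inl h)]
  | succ k ih =>
    intro n m m' h h1 h2
    rw [pS_rec, pS_rec n m', ih (n - 1) (m - 2) (m' - 2) (by omega) (by omega) (by omega)]
    by_cases hn : n < 0 <;> omega

end VectorPartitions

/-- Under `(n,m) ↦ x^(m-n) y^n` the four vectors of `S` become `y/x`, `x`, `y`, `xy`. The proof
multiplies the candidate series by the four factors in turn: `1 - xy` leaves the slice counts, `1 -
y` the indicator of the cone `j ≥ 0`, `i + j ≥ 0`, `1 - x` that of its edge `i + j = 0`, and `1 -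
y/x` the constant 1. -/
theorem coeffXY_Fbar22 (i j : ℤ) : coeffXY Fbar22 i j = pS j (j + i) := by
  set f : IterLaurent := ofCoeff (fun i j => (pS j (j + i) : ℚ))
    (fun i j h => by simp [pS_eq_zero (n := j) (m := j + i) (by omega)]) with hf
  have key : (1 - varY / varX) * (1 - varX * varY) * (1 - varX) * (1 - varY) * f = 1 := by
    have e1 : varY / varX = varX ^ (-1 : ℤ) * varY ^ (1 : ℤ) := by
      rw [zpow_neg_one, zpow_one, div_eq_inv_mul]
    have e2 : varX * varY = varX ^ (1 : ℤ) * varY ^ (1 : ℤ) := by simp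
    have e3 : varX = varX ^ (1 : ℤ) * varY ^ (0 : ℤ) := by simp
    have e4 : varY = varX ^ (0 : ℤ) * varY ^ (1 : ℤ) := by simp
    have h1 : ∀ i j, coeffXY ((1 - varX * varY) * f) i j = ((min j (j + i) + 1).toNat : ℚ) := by
      intro i j
      rw [coeffXY_one_sub_mul _ _ e2, hf, coeffXY_ofCoeff, coeffXY_ofCoeff,
        pS_rec j, show j - 1 + (i - 1) = j + i - 2 by ring]
      push_cast
      ring
    have h2 : ∀ i j, coeffXY ((1 - varY) * ((1 - varX * varY) * f)) i j =
        if 0 ≤ j ∧ 0 ≤ j + i then 1 else 0 := by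
      intro i j
      rw [coeffXY_one_sub_mul _ _ e4, h1, h1]
      split_ifs with h
      · rw [sub_eq_iff_eq_add]
        norm_cast
        omega
      · rw [sub_eq_zero]
        norm_cast
        omega
    have h3 : ∀ i j, coeffXY ((1 - varX) * ((1 - varY) * ((1 - varX * varY) * f))) i j =
        if 0 ≤ j ∧ j + i = 0 then 1 else 0 := by
      intro i j
      rw [coeffXY_one_sub_mul _ _ e3, h2, h2]
      split_ifs <;> first | omega | norm_num
    rw [show (1 - varY / varX) * (1 - varX * varY) * (1 - varX) * (1 - varY) * f =
      (1 - varY / varX) * ((1 - varX) * ((1 - varY) * ((1 - varX * varY) * f))) by ring]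
    refine IterLaurent.ext_coeffXY fun i j => ?_
    rw [coeffXY_one_sub_mul _ _ e1, h3, h3, coeffXY_one]
    split_ifs <;> first | omega | norm_num
  rw [Fbar22, one_div, inv_eq_of_mul_eq_one_right key, hf, coeffXY_ofCoeff]

theorem coeffXY_monomial_mul_Fbar22 (a b i j : ℤ) :
    coeffXY (varX ^ a * varY ^ b * Fbar22) i j = pS (j - b) (j - b + (i - a)) := by
  rw [coeffXY_monomial_mul, coeffXY_Fbar22]

theorem coeffXY_monomial_mul_Fbar22_ne_zero_iff {c : ℚ} (hc : c ≠ 0) (a b i j : ℤ) :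
    coeffXY (const c * (varY ^ b * varX ^ a) * Fbar22) i j ≠ 0 ↔ b ≤ j ∧ b + a ≤ i + j := by
  rw [mul_assoc, coeffXY_const_mul, mul_comm (varY ^ b), coeffXY_monomial_mul_Fbar22]
  simp only [ne_eq, mul_eq_zero, hc, false_or, Nat.cast_eq_zero]
  constructor
  · intro h
    by_contra h'
    exact h (pS_eq_zero (by omega))
  · intro h
    exact pS_pos (by omega) (by omega)

/-! ### Alternants over a commutative ring and divisibility by the Vandermonde. -/

section Alternants

variable {R : Type*} [CommRing R]

theorem map_alternant {S : Type*} [CommRing S] (f : R →+* S) {n : ℕ} (e : Fin n → ℕ)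
    (x : Fin n → R) : f (alternant e x) = alternant e (fun i => f (x i)) := by
  unfold alternant
  rw [RingHom.map_det]
  congr 1
  ext i j
  simp

theorem alternant_comp_perm {n : ℕ} (e : Fin n → ℕ) (x : Fin n → R) (σ : Equiv.Perm (Fin n)) :
    alternant e (x ∘ σ) = Equiv.Perm.sign σ * alternant e x :=
  Matrix.det_permute σ (Matrix.of fun i j => x i ^ e j)

theorem alternant_smul {n : ℕ} (e : Fin n → ℕ) (x : Fin n → R) (t : R) :
    alternant e (fun i => t * x i) = t ^ (∑ j, e j) * alternant e x := by
  unfold alternant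
  rw [← Finset.prod_pow_eq_pow_sum, ← Matrix.det_mul_row]
  simp only [mul_pow, Matrix.of_apply]

/-- Every alternant is divisible by the Vandermonde alternant `a_{δ_n}`. -/
theorem alternant_staircase_dvd [Nontrivial R] {n : ℕ} (e : Fin n → ℕ) (x : Fin n → R) :
    alternant (staircase n) x ∣ alternant e x := by
  classical
  let p : Polynomial R := ∏ i, (Polynomial.X - Polynomial.C (x i))
  have hp : p.Monic := Polynomial.monic_prod_of_monic _ _ fun i _ => Polynomial.monic_X_sub_C _
  have hdeg : p.natDegree = n := by simp [p]
  have hroot : ∀ i, p.eval (x i) = 0 := fun i => by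
    rw [Polynomial.eval_prod]
    exact Finset.prod_eq_zero (Finset.mem_univ i) (by simp)
  -- The remainder of `X^(e j)` modulo `p` has degree below `n` and takes the same values at the
  -- roots `x i`, so the matrix factors through the Vandermonde matrix. The `x i` need not be
  -- distinct.
  have hM : (Matrix.of fun i j => x i ^ e j : Matrix (Fin n) (Fin n) R) =
      (Matrix.of fun i j => x i ^ staircase n j) *
        (Matrix.of fun k j => ((Polynomial.X ^ e j : Polynomial R) %ₘ p).coeff (staircase n k)) := by
    ext i j
    have h1 : x i ^ e j = ((Polynomial.X ^ e j : Polynomial R) %ₘ p).eval (x i) := by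
      conv_lhs => rw [← Polynomial.eval_X (x := x i), ← Polynomial.eval_pow,
        ← Polynomial.modByMonic_add_div (Polynomial.X ^ e j) p]
      simp [hroot]
    have h2 : ((Polynomial.X ^ e j : Polynomial R) %ₘ p).natDegree < n := by
      rw [← hdeg]
      refine Polynomial.natDegree_modByMonic_lt _ hp fun h => ?_
      rw [h, Polynomial.natDegree_one] at hdeg
      exact (hdeg ▸ i).elim0
    rw [Matrix.of_apply, h1, Matrix.mul_apply, Polynomial.eval_eq_sum_range' h2,
      ← Fin.sum_univ_eq_sum_range fun k => Polynomial.coeff _ k * x i ^ k]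
    -- The staircase lists the degrees in decreasing order, hence the reversal.
    refine Fintype.sum_equiv Fin.revPerm _ _ fun k => ?_
    have hk : staircase n (Fin.revPerm k) = k := by
      simp [staircase]
      omega
    rw [Matrix.of_apply, Matrix.of_apply, hk, mul_comm]
  exact ⟨_, by rw [alternant, hM, Matrix.det_mul, alternant]⟩

end Alternants

/-! ### Antisymmetric polynomials in two pairs of variables. -/

/-- The polynomial ring `ℤ[x₁, x₂, y₁, y₂]`. -/
abbrev Poly22 : Type := MvPolynomial (Fin 2 ⊕ Fin 2) ℤ

namespace Poly22

open MvPolynomial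

/-- The alphabet `X`. -/
def x (i : Fin 2) : Poly22 := X (Sum.inl i)

/-- The alphabet `Y`. -/
def y (i : Fin 2) : Poly22 := X (Sum.inr i)

/-- The alphabet `XY`. -/
def xy (k : Fin (2 * 2)) : Poly22 :=
  x (finProdFinEquiv.symm k).1 * y (finProdFinEquiv.symm k).2

/-- The exponent vector with the given entries. -/
def expo (a b c d : ℕ) : Fin 2 ⊕ Fin 2 →₀ ℕ :=
  Finsupp.equivFunOnFinite.symm (Sum.elim ![a, b] ![c, d])

theorem eq_expo (d : Fin 2 ⊕ Fin 2 →₀ ℕ) :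
    d = expo (d (.inl 0)) (d (.inl 1)) (d (.inr 0)) (d (.inr 1)) := by
  ext (i | i) <;> fin_cases i <;> rfl

theorem expo_inj {a b c d a' b' c' d' : ℕ} :
    expo a b c d = expo a' b' c' d' ↔ a = a' ∧ b = b' ∧ c = c' ∧ d = d' := by
  simp [expo, Sum.elim_eq_iff, and_assoc]

theorem coeff_xy_monomial (a b c d : ℕ) (e : Fin 2 ⊕ Fin 2 →₀ ℕ) :
    coeff e (x 0 ^ a * x 1 ^ b * (y 0 ^ c * y 1 ^ d)) = if expo a b c d = e then 1 else 0 := by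
  have : (x 0 ^ a * x 1 ^ b * (y 0 ^ c * y 1 ^ d)) = monomial (expo a b c d) (1 : ℤ) := by
    rw [monomial_eq, Finsupp.prod_fintype _ _ (by simp)]
    simp [expo, x, y]
  rw [this, coeff_monomial]

/-- The automorphism swapping `x₁` and `x₂`. -/
def swapX : Poly22 →ₐ[ℤ] Poly22 := rename (Sum.map (Equiv.swap 0 1) id)

/-- The automorphism swapping `y₁` and `y₂`. -/
def swapY : Poly22 →ₐ[ℤ] Poly22 := rename (Sum.map id (Equiv.swap 0 1))

theorem coeff_swapX (f : Poly22) (a b c d : ℕ) :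
    coeff (expo b a c d) (swapX f) = coeff (expo a b c d) f := by
  have hinj : Function.Injective (Sum.map (Equiv.swap (0 : Fin 2) 1) (id : Fin 2 → Fin 2)) :=
    Sum.map_injective.2 ⟨(Equiv.swap _ _).injective, Function.injective_id⟩
  rw [← coeff_rename_mapDomain _ hinj f (expo a b c d), swapX]
  congr 1
  ext i
  obtain ⟨j, rfl⟩ : ∃ j, Sum.map (Equiv.swap (0 : Fin 2) 1) (id : Fin 2 → Fin 2) j = i := by
    rcases i with i | i
    · exact ⟨.inl (Equiv.swap 0 1 i), by simp⟩
    · exact ⟨.inr i, rfl⟩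
  rw [Finsupp.mapDomain_apply hinj]
  rcases j with j | j <;> fin_cases j <;> rfl

theorem coeff_swapY (f : Poly22) (a b c d : ℕ) :
    coeff (expo a b d c) (swapY f) = coeff (expo a b c d) f := by
  have hinj : Function.Injective (Sum.map (id : Fin 2 → Fin 2) (Equiv.swap (0 : Fin 2) 1)) :=
    Sum.map_injective.2 ⟨Function.injective_id, (Equiv.swap _ _).injective⟩
  rw [← coeff_rename_mapDomain _ hinj f (expo a b c d), swapY]
  congr 1
  ext i
  obtain ⟨j, rfl⟩ : ∃ j, Sum.map (id : Fin 2 → Fin 2) (Equiv.swap (0 : Fin 2) 1) j = i := by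
    rcases i with i | i
    · exact ⟨.inl i, rfl⟩
    · exact ⟨.inr (Equiv.swap 0 1 i), by simp⟩
  rw [Finsupp.mapDomain_apply hinj]
  rcases j with j | j <;> fin_cases j <;> rfl

/-- Antisymmetric in `X` and in `Y`. -/
def IsAntisymm (f : Poly22) : Prop := swapX f = -f ∧ swapY f = -f

theorem IsAntisymm.sub {f g : Poly22} (hf : IsAntisymm f) (hg : IsAntisymm g) :
    IsAntisymm (f - g) := by
  constructor
  · rw [map_sub, hf.1, hg.1]; ring
  · rw [map_sub, hf.2, hg.2]; ring

/-- An antisymmetric polynomial whose coefficients at strictly dominant exponents vanish is zero. -/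
theorem IsAntisymm.eq_zero {f : Poly22} (hf : IsAntisymm f)
    (h : ∀ a b c d, b < a → d < c → coeff (expo a b c d) f = 0) : f = 0 := by
  have hX : ∀ a b c d, coeff (expo b a c d) f = -coeff (expo a b c d) f := fun a b c d => by
    have := coeff_swapX f a b c d
    rw [hf.1, coeff_neg] at this
    omega
  have hY : ∀ a b c d, coeff (expo a b d c) f = -coeff (expo a b c d) f := fun a b c d => by
    have := coeff_swapY f a b c d
    rw [hf.2, coeff_neg] at this
    omega
  have h1 : ∀ a b c d, d < c → coeff (expo a b c d) f = 0 := fun a b c d hcd => by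
    rcases lt_trichotomy a b with hab | rfl | hab
    · rw [hX, h _ _ _ _ hab hcd, neg_zero]
    -- A coefficient on the diagonal is its own negative.
    · have := hX a a c d
      omega
    · exact h _ _ _ _ hab hcd
  ext e
  rw [eq_expo e, coeff_zero]
  rcases lt_trichotomy (e (.inr 0)) (e (.inr 1)) with hcd | hcd | hcd
  · rw [hY, h1 _ _ _ _ hcd, neg_zero]
  · rw [hcd]
    have := hY (e (.inl 0)) (e (.inl 1)) (e (.inr 1)) (e (.inr 1))
    omega
  · exact h1 _ _ _ _ hcd

theorem swapX_x (i : Fin 2) : swapX (x i) = x (Equiv.swap 0 1 i) := by simp [swapX, x]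
theorem swapX_y (i : Fin 2) : swapX (y i) = y i := by simp [swapX, y]
theorem swapY_x (i : Fin 2) : swapY (x i) = x i := by simp [swapY, x]
theorem swapY_y (i : Fin 2) : swapY (y i) = y (Equiv.swap 0 1 i) := by simp [swapY, y]

/-- The product `a_{μ+δ}(X) a_{ν+δ}(Y)`. -/
def altProd (p : BoundedPartition 2 × BoundedPartition 2) : Poly22 :=
  alternant (fun j => p.1 j + staircase 2 j) x * alternant (fun j => p.2 j + staircase 2 j) y

theorem alternant_two_antisymm {R : Type*} [CommRing R] (e : Fin 2 → ℕ) (z : Fin 2 → R) :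
    alternant e (fun i => z (Equiv.swap 0 1 i)) = -alternant e z := by
  have := alternant_comp_perm e z (Equiv.swap 0 1)
  rw [Equiv.Perm.sign_swap (by decide)] at this
  simpa [Function.comp_def] using this

theorem altProd_isAntisymm (p : BoundedPartition 2 × BoundedPartition 2) :
    IsAntisymm (altProd p) := by
  unfold altProd
  constructor
  · have h1 := map_alternant (swapX : Poly22 →+* Poly22) (fun j => p.1 j + staircase 2 j) x
    have h2 := map_alternant (swapX : Poly22 →+* Poly22) (fun j => p.2 j + staircase 2 j) y
    simp only [RingHom.coe_coe, swapX_x, swapX_y, alternant_two_antisymm] at h1 h2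
    rw [map_mul, h1, h2, neg_mul]
  · have h1 := map_alternant (swapY : Poly22 →+* Poly22) (fun j => p.1 j + staircase 2 j) x
    have h2 := map_alternant (swapY : Poly22 →+* Poly22) (fun j => p.2 j + staircase 2 j) y
    simp only [RingHom.coe_coe, swapY_x, swapY_y, alternant_two_antisymm] at h1 h2
    rw [map_mul, h1, h2, mul_neg]

/-- The leading exponent of `a_{μ+δ}(X) a_{ν+δ}(Y)`. -/
def lead (p : BoundedPartition 2 × BoundedPartition 2) : Fin 2 ⊕ Fin 2 →₀ ℕ :=
  expo (p.1 0 + 1) (p.1 1) (p.2 0 + 1) (p.2 1)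

theorem boundedPartition_two_ext {μ ν : BoundedPartition 2} (h0 : μ 0 = ν 0) (h1 : μ 1 = ν 1) :
    μ = ν := by
  cases μ
  cases ν
  congr
  ext i
  fin_cases i
  · exact h0
  · exact h1

theorem lead_injective : Function.Injective lead := by
  intro p q h
  obtain ⟨h1, h2, h3, h4⟩ := expo_inj.1 h
  exact Prod.ext (boundedPartition_two_ext (by omega) h2) (boundedPartition_two_ext (by omega) h4)

theorem exists_lead_eq {a b c d : ℕ} (hab : b < a) (hcd : d < c) :
    ∃ p, lead p = expo a b c d := by
  refine ⟨(⟨![a - 1, b], ?_⟩, ⟨![c - 1, d], ?_⟩), ?_⟩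
  · rw [Fin.antitone_iff_succ_le]
    simp
    omega
  · rw [Fin.antitone_iff_succ_le]
    simp
    omega
  · simp [lead]
    congr 1 <;> omega

-- Of the four monomials in the product of two 2×2 alternants, only one is strictly dominant in both
-- alphabets.
open Classical in
theorem coeff_lead_altProd (p q : BoundedPartition 2 × BoundedPartition 2) :
    coeff (lead q) (altProd p) = if p = q then 1 else 0 := by
  have hp1 := p.1.antitone (show (0 : Fin 2) ≤ 1 by decide)
  have hp2 := p.2.antitone (show (0 : Fin 2) ≤ 1 by decide)
  have hq1 := q.1.antitone (show (0 : Fin 2) ≤ 1 by decide)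
  have hq2 := q.2.antitone (show (0 : Fin 2) ≤ 1 by decide)
  have : altProd p = x 0 ^ (p.1 0 + 1) * x 1 ^ p.1 1 * (y 0 ^ (p.2 0 + 1) * y 1 ^ p.2 1)
      - x 0 ^ p.1 1 * x 1 ^ (p.1 0 + 1) * (y 0 ^ (p.2 0 + 1) * y 1 ^ p.2 1)
      - x 0 ^ (p.1 0 + 1) * x 1 ^ p.1 1 * (y 0 ^ p.2 1 * y 1 ^ (p.2 0 + 1))
      + x 0 ^ p.1 1 * x 1 ^ (p.1 0 + 1) * (y 0 ^ p.2 1 * y 1 ^ (p.2 0 + 1)) := by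
    simp [altProd, alternant, Matrix.det_fin_two, staircase]
    ring
  rw [this, coeff_add, coeff_sub, coeff_sub, coeff_xy_monomial, coeff_xy_monomial,
    coeff_xy_monomial, coeff_xy_monomial]
  simp only [← lead_injective.eq_iff (a := p) (b := q), lead, expo_inj]
  split_ifs <;> omega

open Classical in
/-- The expansion of an antisymmetric polynomial in products of alternants. -/
theorem IsAntisymm.eq_sum_altProd_iff {f : Poly22} (hf : IsAntisymm f)
    (g : BoundedPartition 2 × BoundedPartition 2 →₀ ℤ) :
    f = (g.sum fun p c => (c : Poly22) * altProd p) ↔ ∀ p, g p = coeff (lead p) f := by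
  have hsum : ∀ q, coeff (lead q) (g.sum fun p c => (c : Poly22) * altProd p) = g q := by
    intro q
    rw [Finsupp.sum, coeff_sum, Finset.sum_congr rfl (g := fun p => if p = q then g p else 0)]
    · simp +contextual [eq_comm]
    · intro p _
      rw [← map_intCast (C : ℤ →+* Poly22), coeff_C_mul, coeff_lead_altProd]
      simp
  constructor
  · rintro rfl p
    rw [hsum]
  · intro h
    rw [← sub_eq_zero]
    refine (hf.sub ?_).eq_zero fun a b c d hab hcd => ?_
    · constructor
      · rw [Finsupp.sum, map_sum, ← Finset.sum_neg_distrib]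
        refine Finset.sum_congr rfl fun p _ => ?_
        rw [map_mul, (altProd_isAntisymm p).1, map_intCast, mul_neg]
      · rw [Finsupp.sum, map_sum, ← Finset.sum_neg_distrib]
        refine Finset.sum_congr rfl fun p _ => ?_
        rw [map_mul, (altProd_isAntisymm p).2, map_intCast, mul_neg]
    · obtain ⟨p, hp⟩ := exists_lead_eq hab hcd
      rw [← hp, coeff_sub, hsum, h p, sub_self]

theorem finite_lead_support (f : Poly22) :
    {p | coeff (lead p) f ≠ 0}.Finite :=
  (f.support.finite_toSet.preimage lead_injective.injOn).subset fun p hp => by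
    simpa using hp

/-- The coefficients of the expansion of an antisymmetric polynomial. -/
def leadCoeffs (f : Poly22) : BoundedPartition 2 × BoundedPartition 2 →₀ ℤ :=
  Finsupp.ofSupportFinite (fun p => coeff (lead p) f) (finite_lead_support f)

end Poly22

/-! ### Explicit alternants of sizes two and four. -/

section Alternants

variable {R : Type*} [CommRing R]

theorem alternant_two (e : Fin 2 → ℕ) (z : Fin 2 → R) :
    alternant e z = z 0 ^ e 0 * z 1 ^ e 1 - z 0 ^ e 1 * z 1 ^ e 0 := by
  simp [alternant, Matrix.det_fin_two]

theorem alternant_four (e : Fin 4 → ℕ) (z : Fin 4 → R) :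
    alternant e z =
      z 0 ^ e 0 * z 1 ^ e 1 * z 2 ^ e 2 * z 3 ^ e 3 - z 0 ^ e 0 * z 1 ^ e 1 * z 2 ^ e 3 * z 3 ^ e 2
      - z 0 ^ e 0 * z 1 ^ e 2 * z 2 ^ e 1 * z 3 ^ e 3 + z 0 ^ e 0 * z 1 ^ e 2 * z 2 ^ e 3 * z 3 ^ e 1
      + z 0 ^ e 0 * z 1 ^ e 3 * z 2 ^ e 1 * z 3 ^ e 2 - z 0 ^ e 0 * z 1 ^ e 3 * z 2 ^ e 2 * z 3 ^ e 1
      - z 0 ^ e 1 * z 1 ^ e 0 * z 2 ^ e 2 * z 3 ^ e 3 + z 0 ^ e 1 * z 1 ^ e 0 * z 2 ^ e 3 * z 3 ^ e 2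
      + z 0 ^ e 1 * z 1 ^ e 2 * z 2 ^ e 0 * z 3 ^ e 3 - z 0 ^ e 1 * z 1 ^ e 2 * z 2 ^ e 3 * z 3 ^ e 0
      - z 0 ^ e 1 * z 1 ^ e 3 * z 2 ^ e 0 * z 3 ^ e 2 + z 0 ^ e 1 * z 1 ^ e 3 * z 2 ^ e 2 * z 3 ^ e 0
      + z 0 ^ e 2 * z 1 ^ e 0 * z 2 ^ e 1 * z 3 ^ e 3 - z 0 ^ e 2 * z 1 ^ e 0 * z 2 ^ e 3 * z 3 ^ e 1
      - z 0 ^ e 2 * z 1 ^ e 1 * z 2 ^ e 0 * z 3 ^ e 3 + z 0 ^ e 2 * z 1 ^ e 1 * z 2 ^ e 3 * z 3 ^ e 0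
      + z 0 ^ e 2 * z 1 ^ e 3 * z 2 ^ e 0 * z 3 ^ e 1 - z 0 ^ e 2 * z 1 ^ e 3 * z 2 ^ e 1 * z 3 ^ e 0
      - z 0 ^ e 3 * z 1 ^ e 0 * z 2 ^ e 1 * z 3 ^ e 2 + z 0 ^ e 3 * z 1 ^ e 0 * z 2 ^ e 2 * z 3 ^ e 1
      + z 0 ^ e 3 * z 1 ^ e 1 * z 2 ^ e 0 * z 3 ^ e 2 - z 0 ^ e 3 * z 1 ^ e 1 * z 2 ^ e 2 * z 3 ^ e 0
      - z 0 ^ e 3 * z 1 ^ e 2 * z 2 ^ e 0 * z 3 ^ e 1 + z 0 ^ e 3 * z 1 ^ e 2 * z 2 ^ e 1 * z 3 ^ e 0 := by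
  simp [alternant, Matrix.det_succ_row_zero, Fin.sum_univ_succ, Fin.succAbove]
  ring

theorem alternant_staircase_two (z : Fin 2 → R) : alternant (staircase 2) z = z 0 - z 1 := by
  simp [alternant_two, staircase]

theorem alternant_staircase_four (z : Fin 4 → R) :
    alternant (staircase 4) z =
      (z 0 - z 1) * (z 0 - z 2) * (z 0 - z 3) * (z 1 - z 2) * (z 1 - z 3) * (z 2 - z 3) := by
  simp [alternant_four, staircase]
  ring

end Alternants

/-! ### The integral Schur polynomial of the product alphabet and its symmetry. -/

namespace Poly22

open MvPolynomial

theorem xy_eq : xy = ![x 0 * y 0, x 0 * y 1, x 1 * y 0, x 1 * y 1] := by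
  funext k
  fin_cases k <;> rfl

theorem alternant_staircase_xy_ne_zero : alternant (staircase (2 * 2)) xy ≠ 0 := by
  intro h
  -- At `X = (1, 5)`, `Y = (2, 3)` the four products 2, 3, 10, 15 are distinct.
  have := congrArg (eval (Sum.elim ![(1 : ℤ), 5] ![2, 3])) h
  rw [map_alternant, map_zero] at this
  simp [xy_eq, alternant_staircase_four, x, y] at this

/-- The Schur polynomial `s_λ[XY]`, with integer coefficients. -/
def schurXY (lam : BoundedPartition (2 * 2)) : Poly22 :=
  (alternant_staircase_dvd (fun j => lam j + staircase (2 * 2) j) xy).choose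

theorem alternant_xy_eq (lam : BoundedPartition (2 * 2)) :
    alternant (fun j => lam j + staircase (2 * 2) j) xy =
      alternant (staircase (2 * 2)) xy * schurXY lam :=
  (alternant_staircase_dvd (fun j => lam j + staircase (2 * 2) j) xy).choose_spec

/-- The antisymmetric polynomial `s_λ[XY] a_δ(X) a_δ(Y)`. -/
def antiSchurXY (lam : BoundedPartition (2 * 2)) : Poly22 :=
  schurXY lam * (x 0 - x 1) * (y 0 - y 1)

theorem swapX_alternant_xy (e : Fin (2 * 2) → ℕ) :
    swapX (alternant e xy) = alternant e xy := by
  have h := map_alternant (swapX : Poly22 →+* Poly22) e xy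
  -- Swapping `x₁` and `x₂` permutes the four letters by two disjoint transpositions, an even
  -- permutation, so the alternant is unchanged.
  have hσ : (fun k => (swapX : Poly22 →+* Poly22) (xy k)) =
      xy ∘ (Equiv.swap (0 : Fin (2 * 2)) 2 * Equiv.swap 1 3 : Equiv.Perm (Fin (2 * 2))) := by
    funext k
    simp only [RingHom.coe_coe, xy, map_mul, swapX_x, swapX_y, Function.comp]
    fin_cases k <;> rfl
  rw [hσ, alternant_comp_perm] at h
  rw [← RingHom.coe_coe, h, Equiv.Perm.sign_mul, Equiv.Perm.sign_swap (by decide),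
    Equiv.Perm.sign_swap (by decide)]
  simp

theorem swapY_alternant_xy (e : Fin (2 * 2) → ℕ) :
    swapY (alternant e xy) = alternant e xy := by
  have h := map_alternant (swapY : Poly22 →+* Poly22) e xy
  have hσ : (fun k => (swapY : Poly22 →+* Poly22) (xy k)) =
      xy ∘ (Equiv.swap (0 : Fin (2 * 2)) 1 * Equiv.swap 2 3 : Equiv.Perm (Fin (2 * 2))) := by
    funext k
    simp only [RingHom.coe_coe, xy, map_mul, swapY_x, swapY_y, Function.comp]
    fin_cases k <;> rfl
  rw [hσ, alternant_comp_perm] at h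
  rw [← RingHom.coe_coe, h, Equiv.Perm.sign_mul, Equiv.Perm.sign_swap (by decide),
    Equiv.Perm.sign_swap (by decide)]
  simp

theorem swapX_schurXY (lam : BoundedPartition (2 * 2)) : swapX (schurXY lam) = schurXY lam := by
  refine mul_left_cancel₀ alternant_staircase_xy_ne_zero ?_
  conv_lhs => rw [← swapX_alternant_xy]
  rw [← map_mul, ← alternant_xy_eq, swapX_alternant_xy]

theorem swapY_schurXY (lam : BoundedPartition (2 * 2)) : swapY (schurXY lam) = schurXY lam := by
  refine mul_left_cancel₀ alternant_staircase_xy_ne_zero ?_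
  conv_lhs => rw [← swapY_alternant_xy]
  rw [← map_mul, ← alternant_xy_eq, swapY_alternant_xy]

theorem antiSchurXY_isAntisymm (lam : BoundedPartition (2 * 2)) :
    IsAntisymm (antiSchurXY lam) := by
  constructor
  · simp only [antiSchurXY, map_mul, map_sub, swapX_schurXY, swapX_x, swapX_y,
      Equiv.swap_apply_left, Equiv.swap_apply_right]
    ring
  · simp only [antiSchurXY, map_mul, map_sub, swapY_schurXY, swapY_x, swapY_y,
      Equiv.swap_apply_left, Equiv.swap_apply_right]
    ring

/-! ### Bihomogeneity. -/

/-- The grading homomorphism `x_i ↦ T^a x_i`, `y_j ↦ T^b y_j`. -/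
def grade (a b : ℕ) : Poly22 →ₐ[ℤ] Polynomial Poly22 :=
  aeval (Sum.elim (fun i => Polynomial.X ^ a * Polynomial.C (x i))
    (fun i => Polynomial.X ^ b * Polynomial.C (y i)))

theorem grade_monomial (a b : ℕ) (e : Fin 2 ⊕ Fin 2 →₀ ℕ) (c : ℤ) :
    grade a b (monomial e c) =
      Polynomial.X ^ (a * (e (.inl 0) + e (.inl 1)) + b * (e (.inr 0) + e (.inr 1))) *
        Polynomial.C (monomial e c) := by
  rw [grade, aeval_monomial, monomial_eq, Finsupp.prod_fintype _ _ (by simp),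
    Finsupp.prod_fintype _ _ (by simp)]
  simp [x, y, mul_pow]
  ring

/-- Consequently, if `grade a b f` is `T^N` times `f`, every exponent occurring in `f` has weighted
degree `N`. -/
theorem coeff_coeff_grade (a b : ℕ) (f : Poly22) (e : Fin 2 ⊕ Fin 2 →₀ ℕ) :
    coeff e ((grade a b f).coeff
      (a * (e (.inl 0) + e (.inl 1)) + b * (e (.inr 0) + e (.inr 1)))) = coeff e f := by
  classical
  induction f using MvPolynomial.induction_on' with
  | monomial u c =>
    rw [grade_monomial, mul_comm, Polynomial.coeff_C_mul_X_pow]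
    by_cases h : u = e
    · simp [h]
    · split_ifs <;> simp [coeff_monomial, h]
  | add p q hp hq => rw [map_add, Polynomial.coeff_add, coeff_add, coeff_add, hp, hq]

/-- When `a + b = 1` each letter `x_i y_j` is scaled by exactly one factor `T`. The cases `(1,0)`
and `(0,1)` give the degrees in `X` and in `Y`. -/
theorem grade_alternant_xy {a b : ℕ} (hab : a + b = 1) (e : Fin (2 * 2) → ℕ) :
    grade a b (alternant e xy) =
      Polynomial.X ^ (∑ j, e j) * Polynomial.C (alternant e xy) := by
  have h := map_alternant (grade a b : Poly22 →+* Polynomial Poly22) e xy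
  have hz : (fun k => (grade a b : Poly22 →+* Polynomial Poly22) (xy k)) =
      fun k => Polynomial.X * Polynomial.C (xy k) := by
    funext k
    simp only [RingHom.coe_coe, xy, grade, x, y, map_mul, aeval_X, Sum.elim_inl, Sum.elim_inr]
    rw [mul_mul_mul_comm, ← pow_add, hab, pow_one]
  rw [hz, alternant_smul, ← map_alternant] at h
  exact h

theorem grade_schurXY {a b : ℕ} (hab : a + b = 1) (lam : BoundedPartition (2 * 2)) :
    grade a b (schurXY lam) = Polynomial.X ^ lam.weight * Polynomial.C (schurXY lam) := by
  have h := grade_alternant_xy hab (fun j => lam j + staircase (2 * 2) j)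
  rw [alternant_xy_eq, map_mul, grade_alternant_xy hab, Finset.sum_add_distrib, pow_add,
    map_mul] at h
  refine mul_left_cancel₀ (a := Polynomial.X ^ (∑ j, staircase (2 * 2) j) *
    Polynomial.C (alternant (staircase (2 * 2)) xy)) ?_ ?_
  · exact mul_ne_zero (pow_ne_zero _ Polynomial.X_ne_zero)
      (Polynomial.C_ne_zero.2 alternant_staircase_xy_ne_zero)
  · rw [h, BoundedPartition.weight]
    ring

theorem grade_antiSchurXY {a b : ℕ} (hab : a + b = 1) (lam : BoundedPartition (2 * 2)) :
    grade a b (antiSchurXY lam) =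
      Polynomial.X ^ (lam.weight + 1) * Polynomial.C (antiSchurXY lam) := by
  have hx : ∀ i, grade a b (x i) = Polynomial.X ^ a * Polynomial.C (x i) := by simp [grade, x]
  have hy : ∀ i, grade a b (y i) = Polynomial.X ^ b * Polynomial.C (y i) := by simp [grade, y]
  simp only [antiSchurXY, map_mul, map_sub, grade_schurXY hab, hx, hy]
  rw [← hab, pow_add, pow_add]
  ring

/-- `s_λ[XY] a_δ(X) a_δ(Y)` is bihomogeneous of degree `|λ| + 1` in `X` and in `Y`. -/
theorem degree_of_coeff_antiSchurXY_ne_zero {lam : BoundedPartition (2 * 2)}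
    {e : Fin 2 ⊕ Fin 2 →₀ ℕ} (he : coeff e (antiSchurXY lam) ≠ 0) :
    e (.inl 0) + e (.inl 1) = lam.weight + 1 ∧ e (.inr 0) + e (.inr 1) = lam.weight + 1 := by
  have key : ∀ a b : ℕ, a + b = 1 →
      a * (e (.inl 0) + e (.inl 1)) + b * (e (.inr 0) + e (.inr 1)) = lam.weight + 1 := by
    intro a b hab
    by_contra hne
    rw [← coeff_coeff_grade a b, grade_antiSchurXY hab, mul_comm, Polynomial.coeff_C_mul_X_pow,
      if_neg hne, coeff_zero] at he
    exact he rfl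
  exact ⟨by simpa using key 1 0 rfl, by simpa using key 0 1 rfl⟩

/-! ### Kronecker coefficients as coefficients of an antisymmetric polynomial. -/

/-- The embedding of `ℤ[x₁, x₂, y₁, y₂]` into `ℚ(x₁, x₂, y₁, y₂)`. -/
def toRatFunc : Poly22 →+* RatFunc2 2 2 :=
  (algebraMap (MvPolynomial (Fin 2 ⊕ Fin 2) ℚ) (RatFunc2 2 2)).comp
    (MvPolynomial.map (Int.castRingHom ℚ))

theorem toRatFunc_injective : Function.Injective toRatFunc :=
  (IsFractionRing.injective (MvPolynomial (Fin 2 ⊕ Fin 2) ℚ) (RatFunc2 2 2)).comp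
    (MvPolynomial.map_injective _ (Int.cast_injective))

theorem toRatFunc_x (i : Fin 2) : toRatFunc (x i) = alphabetX 2 2 i := by
  simp [toRatFunc, x, alphabetX]

theorem toRatFunc_y (i : Fin 2) : toRatFunc (y i) = alphabetY 2 2 i := by
  simp [toRatFunc, y, alphabetY]

theorem toRatFunc_xy (k : Fin (2 * 2)) : toRatFunc (xy k) = alphabetXY 2 2 k := by
  rw [xy, map_mul, toRatFunc_x, toRatFunc_y, alphabetXY]

theorem schur_alphabetXY (lam : BoundedPartition (2 * 2)) :
    schur lam (alphabetXY 2 2) = toRatFunc (schurXY lam) := by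
  have hne : toRatFunc (alternant (staircase (2 * 2)) xy) ≠ 0 :=
    (map_ne_zero_iff _ toRatFunc_injective).2 alternant_staircase_xy_ne_zero
  rw [schur, ← funext toRatFunc_xy, ← map_alternant, ← map_alternant, alternant_xy_eq, map_mul,
    mul_div_cancel_left₀ _ hne]

theorem x_sub_ne_zero : x 0 - x 1 ≠ 0 :=
  sub_ne_zero.2 fun h => by simpa using Sum.inl_injective (X_injective h)

theorem y_sub_ne_zero : y 0 - y 1 ≠ 0 :=
  sub_ne_zero.2 fun h => by simpa using Sum.inr_injective (X_injective h)

theorem schur_mul_schur (p : BoundedPartition 2 × BoundedPartition 2) :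
    schur p.1 (alphabetX 2 2) * schur p.2 (alphabetY 2 2) =
      toRatFunc (altProd p) / toRatFunc ((x 0 - x 1) * (y 0 - y 1)) := by
  rw [schur, schur, ← funext toRatFunc_x, ← funext toRatFunc_y, ← map_alternant, ← map_alternant,
    ← map_alternant, ← map_alternant, alternant_staircase_two, alternant_staircase_two,
    div_mul_div_comm, ← map_mul, ← map_mul, altProd]

/-- All products `s_μ[X] s_ν[Y]` share the denominator `a_δ(X) a_δ(Y)`. Clearing it turns the
expansion into one in products of alternants, which settles existence and uniqueness together. -/
theorem isKroneckerExpansion_iff (lam : BoundedPartition (2 * 2))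
    (g : BoundedPartition 2 × BoundedPartition 2 →₀ ℤ) :
    IsKroneckerExpansion 2 2 lam g ↔ ∀ p, g p = coeff (lead p) (antiSchurXY lam) := by
  have hne : toRatFunc ((x 0 - x 1) * (y 0 - y 1)) ≠ 0 :=
    (map_ne_zero_iff _ toRatFunc_injective).2 (mul_ne_zero x_sub_ne_zero y_sub_ne_zero)
  have hsum : (g.sum fun p c => (c : RatFunc2 2 2) * schur p.1 (alphabetX 2 2) *
      schur p.2 (alphabetY 2 2)) =
      toRatFunc (g.sum fun p c => (c : Poly22) * altProd p) /
        toRatFunc ((x 0 - x 1) * (y 0 - y 1)) := by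
    rw [Finsupp.sum, Finsupp.sum, map_sum, Finset.sum_div]
    refine Finset.sum_congr rfl fun p _ => ?_
    rw [mul_assoc, schur_mul_schur, map_mul toRatFunc (g p : Poly22), map_intCast, mul_div_assoc]
  rw [IsKroneckerExpansion, hsum, schur_alphabetXY, eq_div_iff hne, ← map_mul,
    toRatFunc_injective.eq_iff, ← mul_assoc, ← (antiSchurXY_isAntisymm lam).eq_sum_altProd_iff]
  rfl

theorem existsUnique_isKroneckerExpansion (lam : BoundedPartition (2 * 2)) :
    ∃! g, IsKroneckerExpansion 2 2 lam g :=
  ⟨leadCoeffs (antiSchurXY lam), (isKroneckerExpansion_iff lam _).2 fun _ => rfl,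
    fun _ hg => Finsupp.ext ((isKroneckerExpansion_iff lam _).1 hg)⟩

theorem kroneckerCoeff_eq_coeff (mu nu : BoundedPartition 2) (lam : BoundedPartition (2 * 2)) :
    kroneckerCoeff mu nu lam = coeff (lead (mu, nu)) (antiSchurXY lam) := by
  have h : ∃ g, IsKroneckerExpansion 2 2 lam g := (existsUnique_isKroneckerExpansion lam).exists
  rw [kroneckerCoeff, dif_pos h]
  exact (isKroneckerExpansion_iff lam _).1 h.choose_spec (mu, nu)

end Poly22

/-! ### Specialization to two variables. -/

section CoefficientExtraction

open Poly22 MvPolynomial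

/-- The specialization `x₁ = y₁ = 1`, `x₂ = x`, `y₂ = y`. -/
def specialize : Poly22 →+* IterLaurent :=
  eval₂Hom (Int.castRingHom IterLaurent) (Sum.elim ![1, varX] ![1, varY])

theorem coeffXY_intCast_mul (c : ℤ) (f : IterLaurent) (i j : ℤ) :
    coeffXY (c * f) i j = c * coeffXY f i j := by
  rw [← zsmul_eq_mul, ← coeffXYHom_apply, map_zsmul, zsmul_eq_mul, coeffXYHom_apply]

theorem coeffXY_specialize (f : Poly22) (i j : ℤ) :
    coeffXY (specialize f) i j = ∑ e ∈ f.support,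
      ((coeff e f : ℤ) : ℚ) * if i = e (.inl 1) ∧ j = e (.inr 1) then 1 else 0 := by
  rw [specialize, coe_eval₂Hom, eval₂_eq', ← coeffXYHom_apply, map_sum]
  refine Finset.sum_congr rfl fun e _ => ?_
  rw [coeffXYHom_apply, eq_intCast, coeffXY_intCast_mul]
  congr 1
  rw [← coeffXY_monomial]
  simp

/-- The total degrees in `X` and in `Y` are fixed, so the exponents of `x₂` and `y₂` determine those
of `x₁` and `y₁`: no two monomials merge. -/
theorem coeffXY_specialize_antiSchurXY {mu nu : BoundedPartition 2}
    {lam : BoundedPartition (2 * 2)} (hmu : mu.weight = lam.weight)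
    (hnu : nu.weight = lam.weight) :
    coeffXY (specialize (antiSchurXY lam)) (mu 1) (nu 1) =
      (coeff (lead (mu, nu)) (antiSchurXY lam) : ℤ) := by
  rw [coeffXY_specialize, Finset.sum_eq_single (lead (mu, nu))]
  · simp [lead, expo]
  · intro e he hne
    rw [if_neg, mul_zero]
    rintro ⟨h1, h2⟩
    obtain ⟨h3, h4⟩ := degree_of_coeff_antiSchurXY_ne_zero (mem_support_iff.1 he)
    refine hne ?_
    rw [← hmu, BoundedPartition.weight, Fin.sum_univ_two] at h3
    rw [← hnu, BoundedPartition.weight, Fin.sum_univ_two] at h4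
    rw [eq_expo e, lead, expo_inj]
    dsimp only
    omega
  · intro h
    rw [notMem_support_iff.1 h]
    simp

theorem Fbar22_denominator_mul :
    (1 - varY / varX) * (1 - varX * varY) * (1 - varX) * (1 - varY) * Fbar22 = 1 := by
  -- A zero denominator would give `Fbar22 = 0`, against its nonzero constant term.
  refine mul_one_div_cancel fun h => ?_
  have h1 := coeffXY_Fbar22 0 0
  rw [Fbar22, h, div_zero, ← coeffXYHom_apply, map_zero] at h1
  exact pS_pos (n := 0) (m := 0 + 0) le_rfl (by norm_num) (by exact_mod_cast h1.symm)

theorem specialize_xy (k : Fin (2 * 2)) :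
    specialize (xy k) = (![1, varY, varX, varX * varY] : Fin 4 → IterLaurent) k := by
  fin_cases k <;> simp [xy_eq, specialize, x, y]

theorem specialize_antiSchurXY (lam : BoundedPartition (2 * 2)) :
    specialize (antiSchurXY lam) = varX ^ (-2 : ℤ) * varY ^ (-1 : ℤ) *
      -(alternant (fun j => lam j + staircase (2 * 2) j) ![1, varY, varX, varX * varY] *
        Fbar22) := by
  have hV := congrArg specialize (alternant_xy_eq lam)
  rw [map_mul, map_alternant, map_alternant, funext specialize_xy] at hV
  have hx := varX_ne_zero
  have hy := varY_ne_zero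
  -- Of the six differences, `y - x`, `y - xy` and `x - xy` yield the monomial `-x²y`, the factor `1
  -- - y/x` and second copies of `1 - x` and `1 - y`.
  have hst : alternant (staircase (2 * 2)) ![1, varY, varX, varX * varY] =
      -((1 - varX) * (1 - varY) * varX ^ 2 * varY *
        ((1 - varY / varX) * (1 - varX * varY) * (1 - varX) * (1 - varY))) := by
    refine (alternant_staircase_four _).trans ?_
    simp
    field_simp
    ring
  have hA : specialize (antiSchurXY lam) =
      specialize (schurXY lam) * (1 - varX) * (1 - varY) := by
    simp [antiSchurXY, specialize, x, y]
  have hxy : varX ^ (-2 : ℤ) * varY ^ (-1 : ℤ) * (varX ^ 2 * varY) = 1 := by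
    rw [zpow_neg, zpow_neg_one]
    norm_cast
    field_simp
  rw [hV, hst, hA]
  linear_combination (-(specialize (schurXY lam) * (1 - varX) * (1 - varY))) * hxy -
    (specialize (schurXY lam) * (1 - varX) * (1 - varY) *
      (varX ^ (-2 : ℤ) * varY ^ (-1 : ℤ) * (varX ^ 2 * varY))) * Fbar22_denominator_mul

/-! ### The 24 terms of the determinant. -/

/-- The contribution to the coefficient of `x ^ i * y ^ j` of the monomial of the alternant
`a_e(1, y, x, xy)` with exponents `u, v, w, t` on the four letters. -/
def rowTerm (i j : ℤ) (_u v w t : ℕ) : ℤ :=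
  pS (j + 1 - (v + t)) (j + 1 - (v + t) + (i + 2 - (w + t)))

theorem coeffXY_rowTerm (i j : ℤ) (u v w t : ℕ) :
    coeffXY (1 ^ u * varY ^ v * varX ^ w * (varX * varY) ^ t * Fbar22) (i + 2) (j + 1) =
      rowTerm i j u v w t := by
  have : (1 ^ u * varY ^ v * varX ^ w * (varX * varY) ^ t * Fbar22) =
      varX ^ ((w + t : ℕ) : ℤ) * varY ^ ((v + t : ℕ) : ℤ) * Fbar22 := by
    rw [zpow_natCast, zpow_natCast]
    ring
  rw [this, coeffXY_monomial_mul_Fbar22, rowTerm]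
  push_cast
  rfl

theorem rowTerm_eq {i j : ℤ} {u v w t : ℕ} (p q : ℤ) (hp : (w : ℤ) + t = p + 2)
    (hq : (v : ℤ) + t = q + 1) : rowTerm i j u v w t = pS (j - q) (j - q + (i - p)) := by
  rw [rowTerm, hp, hq]
  congr 2 <;> ring

theorem rowTerm_eq_zero {i j : ℤ} {u v w t : ℕ}
    (h : j + 1 < v + t ∨ i + j + 3 < v + w + 2 * t) : rowTerm i j u v w t = 0 := by
  rw [rowTerm, pS_eq_zero (by omega), Nat.cast_zero]

/-- Equal `v + t` means equal first arguments of `pS`; `h1` and `h2` place both second arguments in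
the stable range `m ≥ 2n`. -/
theorem rowTerm_stable {i j : ℤ} {u v w t u' v' w' t' : ℕ} (h : v + t = v' + t')
    (h1 : j + w ≤ i + 1 + v) (h2 : j + w' ≤ i + 1 + v') :
    rowTerm i j u v w t = rowTerm i j u' v' w' t' := by
  have h' : (v' : ℤ) + t' = v + t := by exact_mod_cast h.symm
  rw [rowTerm, rowTerm, h', pS_stable (j + 1 - (v + t) + 1).toNat] <;> omega

/-- Of the 24 terms of the alternant, 13 do not contribute and 4 cancel in pairs. -/
theorem rowTerm_sum_eq {i j : ℤ} {a b c d : ℕ} (hab : b < a) (hbc : c < b) (hcd : d < c)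
    (hij : j ≤ i) (hi : 2 * i + 6 ≤ a + b + c + d) :
    -(rowTerm i j a b c d
        - rowTerm i j a b d c
        - rowTerm i j a c b d
        + rowTerm i j a c d b
        + rowTerm i j a d b c
        - rowTerm i j a d c b
        - rowTerm i j b a c d
        + rowTerm i j b a d c
        + rowTerm i j b c a d
        - rowTerm i j b c d a
        - rowTerm i j b d a c
        + rowTerm i j b d c a
        + rowTerm i j c a b d
        - rowTerm i j c a d b
        - rowTerm i j c b a d
        + rowTerm i j c b d a
        + rowTerm i j c d a b
        - rowTerm i j c d b a
        - rowTerm i j d a b c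
        + rowTerm i j d a c b
        + rowTerm i j d b a c
        - rowTerm i j d b c a
        - rowTerm i j d c a b
        + rowTerm i j d c b a) =
      - rowTerm i j a b c d
        + rowTerm i j a c b d
        - rowTerm i j a d b c
        + rowTerm i j a d c b
        - rowTerm i j b c a d
        + rowTerm i j b d a c
        + rowTerm i j c b a d := by
  -- In both pairs the exponents `v` and `t`, or `u` and `w`, are exchanged, or the change keeps `v
  -- + t`; the two terms carry opposite signs, and `w < v` with `j ≤ i` gives stability.
  have h1 : rowTerm i j a b d c = rowTerm i j a c d b :=
    rowTerm_stable (by omega) (by omega) (by omega)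
  have h2 : rowTerm i j b a c d = rowTerm i j c a b d :=
    rowTerm_stable (by omega) (by omega) (by omega)
  -- Since `v + w + 2t = (a+b+c+d) - u + t`, the twelve terms with `u < t` exceed `2i + 6` and
  -- vanish. The thirteenth, `(b,a,d,c)`, vanishes because `v + t = a + c` is more than half the
  -- sum.
  rw [h1, h2,
    rowTerm_eq_zero (i := i) (j := j) (u := b) (v := a) (w := d) (t := c) (by omega),
    rowTerm_eq_zero (i := i) (j := j) (u := b) (v := c) (w := d) (t := a) (by omega),
    rowTerm_eq_zero (i := i) (j := j) (u := b) (v := d) (w := c) (t := a) (by omega),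
    rowTerm_eq_zero (i := i) (j := j) (u := c) (v := a) (w := d) (t := b) (by omega),
    rowTerm_eq_zero (i := i) (j := j) (u := c) (v := b) (w := d) (t := a) (by omega),
    rowTerm_eq_zero (i := i) (j := j) (u := c) (v := d) (w := a) (t := b) (by omega),
    rowTerm_eq_zero (i := i) (j := j) (u := c) (v := d) (w := b) (t := a) (by omega),
    rowTerm_eq_zero (i := i) (j := j) (u := d) (v := a) (w := b) (t := c) (by omega),
    rowTerm_eq_zero (i := i) (j := j) (u := d) (v := a) (w := c) (t := b) (by omega),
    rowTerm_eq_zero (i := i) (j := j) (u := d) (v := b) (w := a) (t := c) (by omega),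
    rowTerm_eq_zero (i := i) (j := j) (u := d) (v := b) (w := c) (t := a) (by omega),
    rowTerm_eq_zero (i := i) (j := j) (u := d) (v := c) (w := a) (t := b) (by omega),
    rowTerm_eq_zero (i := i) (j := j) (u := d) (v := c) (w := b) (t := a) (by omega)]
  ring

/-- The signed sum of values of `p_S` for the seven monomials of `P_λ`. -/
def signedPSum (lam : BoundedPartition 4) (i j : ℤ) : ℤ :=
  (pS (j - (lam 2 + lam 3)) (j - (lam 2 + lam 3) + (i - (lam 1 + lam 3))) : ℤ)
    - (pS (j - (lam 2 + lam 3)) (j - (lam 2 + lam 3) + (i - (lam 1 + lam 2 + 1))) : ℤ)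
    - (pS (j - (lam 2 + lam 3)) (j - (lam 2 + lam 3) + (i - (lam 0 + lam 3 + 1))) : ℤ)
    + (pS (j - (lam 2 + lam 3)) (j - (lam 2 + lam 3) + (i - (lam 0 + lam 2 + 2))) : ℤ)
    - (pS (j - (lam 1 + lam 3 + 1)) (j - (lam 1 + lam 3 + 1) + (i - (lam 2 + lam 3 - 1))) : ℤ)
    + (pS (j - (lam 1 + lam 3 + 1)) (j - (lam 1 + lam 3 + 1) + (i - (lam 1 + lam 2 + 1))) : ℤ)
    + (pS (j - (lam 1 + lam 3 + 1)) (j - (lam 1 + lam 3 + 1) + (i - (lam 0 + lam 3 + 1))) : ℤ)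

theorem coeffXY_specialize_antiSchurXY_eq (lam : BoundedPartition 4) {i j : ℤ} (hij : j ≤ i)
    (hi : 2 * i ≤ lam.weight) :
    coeffXY (specialize (antiSchurXY lam)) i j =
      (signedPSum lam i j : ℤ) := by
  have h01 := lam.antitone (show (0 : Fin 4) ≤ 1 by decide)
  have h12 := lam.antitone (show (1 : Fin 4) ≤ 2 by decide)
  have h23 := lam.antitone (show (2 : Fin 4) ≤ 3 by decide)
  rw [BoundedPartition.weight, Fin.sum_univ_four] at hi
  push_cast at hi
  -- The exponents are the parts of `λ + δ`; the staircase adds 6 to the weight, which accounts for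
  -- the 6 in the size hypothesis.
  have hsum := rowTerm_sum_eq (i := i) (j := j) (a := lam 0 + 3) (b := lam 1 + 2)
    (c := lam 2 + 1) (d := lam 3) (by omega) (by omega) (by omega) hij (by push_cast; omega)
  have halt : alternant (fun j => lam j + staircase 4 j)
      ![1, varY, varX, varX * varY] = _ := alternant_four _ _
  have e0 : staircase 4 0 = 3 := rfl
  have e1 : staircase 4 1 = 2 := rfl
  have e2 : staircase 4 2 = 1 := rfl
  have e3 : staircase 4 3 = 0 := rfl
  simp only [e0, e1, e2, e3, add_zero, Matrix.cons_val] at halt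
  rw [specialize_antiSchurXY, coeffXY_monomial_mul, sub_neg_eq_add, sub_neg_eq_add, coeffXY_neg]
  erw [halt]
  simp only [add_mul, sub_mul, coeffXY_add, coeffXY_sub, coeffXY_rowTerm]
  refine Eq.trans ?_ ((congrArg (Int.cast : ℤ → ℚ) hsum).trans ?_)
  · push_cast
    rfl
  congr 1
  rw [signedPSum,
    rowTerm_eq (u := lam 0 + 3) (v := lam 1 + 2) (w := lam 2 + 1) (t := lam 3)
      (lam 2 + lam 3 - 1) (lam 1 + lam 3 + 1)
      (by push_cast; ring) (by push_cast; ring),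
    rowTerm_eq (u := lam 0 + 3) (v := lam 2 + 1) (w := lam 1 + 2) (t := lam 3)
      (lam 1 + lam 3) (lam 2 + lam 3)
      (by push_cast; ring) (by push_cast; ring),
    rowTerm_eq (u := lam 0 + 3) (v := lam 3) (w := lam 1 + 2) (t := lam 2 + 1)
      (lam 1 + lam 2 + 1) (lam 2 + lam 3)
      (by push_cast; ring) (by push_cast; ring),
    rowTerm_eq (u := lam 0 + 3) (v := lam 3) (w := lam 2 + 1) (t := lam 1 + 2)
      (lam 1 + lam 2 + 1) (lam 1 + lam 3 + 1)
      (by push_cast; ring) (by push_cast; ring),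
    rowTerm_eq (u := lam 1 + 2) (v := lam 2 + 1) (w := lam 0 + 3) (t := lam 3)
      (lam 0 + lam 3 + 1) (lam 2 + lam 3)
      (by push_cast; ring) (by push_cast; ring),
    rowTerm_eq (u := lam 1 + 2) (v := lam 3) (w := lam 0 + 3) (t := lam 2 + 1)
      (lam 0 + lam 2 + 2) (lam 2 + lam 3)
      (by push_cast; ring) (by push_cast; ring),
    rowTerm_eq (u := lam 2 + 1) (v := lam 1 + 2) (w := lam 0 + 3) (t := lam 3)
      (lam 0 + lam 3 + 1) (lam 1 + lam 3 + 1)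
      (by push_cast; ring) (by push_cast; ring)]
  abel

theorem coeffXY_polyP_mul_Fbar22 (lam : BoundedPartition 4) (i j : ℤ) :
    coeffXY (polyP lam * Fbar22) i j =
      (signedPSum lam i j : ℤ) := by
  have h : ∀ a b : ℤ, coeffXY (varY ^ b * varX ^ a * Fbar22) i j =
      pS (j - b) (j - b + (i - a)) := fun a b => by
    rw [mul_comm (varY ^ b), coeffXY_monomial_mul_Fbar22]
  simp only [polyP, mul_add, mul_sub, add_mul, sub_mul, mul_neg, neg_mul, coeffXY_add,
    coeffXY_sub, coeffXY_neg, h, signedPSum]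
  push_cast
  ring

end CoefficientExtraction

end Kronecker

end

theorem mainTheorem1
    (lam : Kronecker.BoundedPartition 4) (mu nu : Kronecker.BoundedPartition 2)
    (hmu : mu.weight = lam.weight) (hnu : nu.weight = lam.weight)
    (hle : nu 1 ≤ mu 1) :
    -- the Kronecker coefficients are well defined by the expansion of `s_λ[XY]`
    (∃! g, Kronecker.IsKroneckerExpansion 2 2 lam g) ∧
    -- coefficient of `x ^ μ₂ * y ^ ν₂` in `P_λ * F̄`
    ((Kronecker.kroneckerCoeff (n := 2) (m := 2) mu nu lam : ℚ) =
      Kronecker.coeffXY (Kronecker.polyP lam * Kronecker.Fbar22) (mu 1) (nu 1)) ∧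
    -- a monomial `c * y ^ b * x ^ a` occurring in `P_λ` contributes iff `b ≤ ν₂`, `a + b ≤ μ₂ + ν₂`
    (∀ a b : ℤ, ∀ c : ℚ, c = Kronecker.coeffXY (Kronecker.polyP lam) a b → c ≠ 0 →
      (Kronecker.coeffXY (Kronecker.const c *
          (Kronecker.varY ^ b * Kronecker.varX ^ a) * Kronecker.Fbar22) (mu 1) (nu 1) ≠ 0 ↔
        b ≤ (nu 1 : ℤ) ∧ b + a ≤ (mu 1 : ℤ) + (nu 1 : ℤ))) ∧
    -- the signed sum of seven values of `p_S`
    (∀ l₁ l₂ l₃ l₄ m₂ n₂ : ℤ, l₁ = lam 0 → l₂ = lam 1 → l₃ = lam 2 → l₄ = lam 3 →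
      m₂ = mu 1 → n₂ = nu 1 →
      Kronecker.kroneckerCoeff (n := 2) (m := 2) mu nu lam =
        (Kronecker.pS (n₂ - (l₃ + l₄)) (n₂ - (l₃ + l₄) + (m₂ - (l₂ + l₄))) : ℤ)
        - (Kronecker.pS (n₂ - (l₃ + l₄)) (n₂ - (l₃ + l₄) + (m₂ - (l₂ + l₃ + 1))) : ℤ)
        - (Kronecker.pS (n₂ - (l₃ + l₄)) (n₂ - (l₃ + l₄) + (m₂ - (l₁ + l₄ + 1))) : ℤ)
        + (Kronecker.pS (n₂ - (l₃ + l₄)) (n₂ - (l₃ + l₄) + (m₂ - (l₁ + l₃ + 2))) : ℤ)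
        - (Kronecker.pS (n₂ - (l₂ + l₄ + 1)) (n₂ - (l₂ + l₄ + 1) + (m₂ - (l₃ + l₄ - 1))) : ℤ)
        + (Kronecker.pS (n₂ - (l₂ + l₄ + 1)) (n₂ - (l₂ + l₄ + 1) + (m₂ - (l₂ + l₃ + 1))) : ℤ)
        + (Kronecker.pS (n₂ - (l₂ + l₄ + 1)) (n₂ - (l₂ + l₄ + 1) + (m₂ - (l₁ + l₄ + 1))) : ℤ)) := by
  -- The part `μ₂` is at most half of `|μ| = |λ|`.
  have hmu2 : 2 * (mu 1 : ℤ) ≤ lam.weight := by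
    have h := mu.antitone (show (0 : Fin 2) ≤ 1 by decide)
    rw [← hmu, Kronecker.BoundedPartition.weight, Fin.sum_univ_two]
    omega
  have hq := Kronecker.coeffXY_specialize_antiSchurXY_eq lam (i := mu 1) (j := nu 1)
    (by exact_mod_cast hle) hmu2
  have hg : Kronecker.kroneckerCoeff (n := 2) (m := 2) mu nu lam =
      Kronecker.signedPSum lam (mu 1) (nu 1) := by
    rw [Kronecker.coeffXY_specialize_antiSchurXY hmu hnu] at hq
    rw [Kronecker.Poly22.kroneckerCoeff_eq_coeff]
    exact_mod_cast hq
  refine ⟨Kronecker.Poly22.existsUnique_isKroneckerExpansion lam, ?_, ?_, ?_⟩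
  · rw [hg, Kronecker.coeffXY_polyP_mul_Fbar22]
  · intro a b c _ hc
    exact Kronecker.coeffXY_monomial_mul_Fbar22_ne_zero_iff hc a b _ _
  · rintro l₁ l₂ l₃ l₄ m₂ n₂ rfl rfl rfl rfl rfl rfl
    rw [hg, Kronecker.signedPSum]
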